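/- Let $A\in\mathbb R^{n\times n}$, $B\in\mathbb R^{n\times p}$, let $Q\in\mathbb R^{n\times n}$ be symmetric positive semidefinite and $R\in\mathbb R^{p\times p}$ symmetric positive definite. Let $(w_t)_{t\ge 0}$ be an i.i.d. sequence of random vectors in $\mathbb R^n$ with $\mathbb E\|w_t\|_2^4<\infty$, mean $\bar w=\mathbb E w_t$, covariance $W=\mathbb E(w_t-\bar w)(w_t-\bar w)'$ and $$M_3=\mathbb E\{(w_t-\bar w)(w_t-\bar w)'Q(w_t-\bar w)\}\in\mathbb R^n .$$ For $\mu\ge 0$ put $Q_\mu=Q+4\mu QWQ$. For a horizon $N$, let $V_N=Q_\mu$, $S_N=Q$, $T_N=0$ and, for $1\le t\le N$, \begin{align*} V_{t-1}&=A'V_tA+Q_\mu-A'V_tB(B'V_tB+R)^{-1}B'V_tA, & K_{t-1}&=-(B'V_tB+R)^{-1}B'V_tA,\\ S_{t-1}&=(A+BK_{t-1})'S_t+Q, & T_{t-1}&=(A+BK_{t-1})'(T_t+V_t),\\ l_{t-1}&=-2\mu(B'V_tB+R)^{-1}B'S_tM_3, & h_{t-1}&=-(B'V_tB+R)^{-1}B'(V_t+T_t)\bar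 w \end{align*} (all these quantities depend on $N$). Assume that $(A,B)$ is stabilizable and $(A,Q^{1/2})$ is detectable, i.e. there are real matrices $F$ and $L$ such that $A+BF$ and $A+LQ^{1/2}$ have spectral radius less than $1$. Then for every $\mu\ge 0$ the algebraic Riccati equation $$V=A'VA+Q_\mu-A'VB(B'VB+R)^{-1}B'VA$$ has exactly one stabilizing solution $V$, that is, one for which $B'VB+R$ is invertible and $A+BK$ with $K=-(B'VB+R)^{-1}B'VA$ has spectral radius $\rho(A+BK)<1$. Moreover $I-(A+BK)'$ is invertible and, with \begin{align*} S&=(I-(A+BK)')^{-1}Q, & T&=(I-(A+BK)')^{-1}(A+BK)'V,\\ l&=-2\mu(B'VB+R)^{-1}B'SM_3, & h&=-(B'VB+R)^{-1}B'(V+T)\bar w, \end{align*} one has, as $N\to\infty$, for every $t\ge 0$, $$V_t\to V,\quad K_t\to K,\quad S_t\to S,\quad T_t\to T,\quad l_t\to l,\quad h_t\to h$$ exponentially fast: for each of these quantities, written $X_t\to X$, there are constants $C$ and $\gamma\in(0,1)$ with $\|X_t-X\|\le C\gamma^{N-t}$ for all $0\le t<N$. -/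

import Mathlib

open MeasureTheory ProbabilityTheory
open scoped Matrix MatrixOrder Matrix.Norms.Operator

noncomputable section

namespace RiskLQR

/-- A real square matrix is (Schur) stable when its spectral radius, computed from its complex
eigenvalues, is smaller than one. -/
def IsSchurStable {n : ℕ} (M : Matrix (Fin n) (Fin n) ℝ) : Prop :=
  spectralRadius ℂ (M.map (algebraMap ℝ ℂ)) < 1

/-- `(A, B)` is stabilizable: some state feedback makes `A + B F` stable. -/
def IsStabilizable {n p : ℕ} (A : Matrix (Fin n) (Fin n) ℝ) (B : Matrix (Fin n) (Fin p) ℝ) :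
    Prop :=
  ∃ F : Matrix (Fin p) (Fin n) ℝ, IsSchurStable (A + B * F)

/-- `(A, C)` is detectable: some output injection makes `A + L C` stable. -/
def IsDetectable {n q : ℕ} (A : Matrix (Fin n) (Fin n) ℝ) (C : Matrix (Fin q) (Fin n) ℝ) :
    Prop :=
  ∃ L : Matrix (Fin n) (Fin q) ℝ, IsSchurStable (A + L * C)

section Noise

variable {Ω : Type*} [MeasurableSpace Ω] {n : ℕ}

/-- The mean `E ξ` of a random vector. -/
def mean (P : Measure Ω) (ξ : Ω → EuclideanSpace ℝ (Fin n)) : Fin n → ℝ :=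
  fun i => ∫ ω, ξ ω i ∂P

/-- The deviation `ξ - E ξ`. -/
def dev (P : Measure Ω) (ξ : Ω → EuclideanSpace ℝ (Fin n)) (ω : Ω) : Fin n → ℝ :=
  fun i => ξ ω i - mean P ξ i

/-- The covariance matrix `E (ξ - E ξ)(ξ - E ξ)'`. -/
def cov (P : Measure Ω) (ξ : Ω → EuclideanSpace ℝ (Fin n)) : Matrix (Fin n) (Fin n) ℝ :=
  Matrix.of fun i j => ∫ ω, dev P ξ ω i * dev P ξ ω j ∂P

/-- The weighted third-order statistic `E (ξ - E ξ) (ξ - E ξ)' Q (ξ - E ξ)`. -/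
def thirdMoment (P : Measure Ω) (ξ : Ω → EuclideanSpace ℝ (Fin n))
    (Q : Matrix (Fin n) (Fin n) ℝ) : Fin n → ℝ :=
  fun i => ∫ ω, dev P ξ ω i * (dev P ξ ω ⬝ᵥ (Q *ᵥ dev P ξ ω)) ∂P

end Noise

section Riccati

variable {n p : ℕ}

/-- The inflated state penalty `Q + 4 μ Q W Q`. -/
def inflated (Q W : Matrix (Fin n) (Fin n) ℝ) (μ : ℝ) : Matrix (Fin n) (Fin n) ℝ :=
  Q + (4 * μ) • (Q * W * Q)

variable (A : Matrix (Fin n) (Fin n) ℝ) (B : Matrix (Fin n) (Fin p) ℝ)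
  (R : Matrix (Fin p) (Fin p) ℝ)

/-- The feedback gain `-(B'VB + R)⁻¹ B'VA`. -/
def gain (V : Matrix (Fin n) (Fin n) ℝ) : Matrix (Fin p) (Fin n) ℝ :=
  -((Bᵀ * V * B + R)⁻¹ * Bᵀ * V * A)

/-- The closed-loop matrix `A + B K` for the gain `K` of `V`. -/
def closedLoop (V : Matrix (Fin n) (Fin n) ℝ) : Matrix (Fin n) (Fin n) ℝ :=
  A + B * gain A B R V

/-- The right-hand side of the Riccati equation with state penalty `Qm`. -/
def riccati (Qm V : Matrix (Fin n) (Fin n) ℝ) : Matrix (Fin n) (Fin n) ℝ :=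
  Aᵀ * V * A + Qm - Aᵀ * V * B * (Bᵀ * V * B + R)⁻¹ * Bᵀ * V * A

/-- A stabilizing solution of the algebraic Riccati equation with state penalty `Qm`: the inverse
in the equation exists, the equation holds, and `A + B K` is stable. -/
structure IsStabilizingSolution (Qm V : Matrix (Fin n) (Fin n) ℝ) : Prop where
  isUnit : IsUnit (Bᵀ * V * B + R)
  eq : V = riccati A B R Qm V
  stable : IsSchurStable (closedLoop A B R V)

variable (Q W : Matrix (Fin n) (Fin n) ℝ) (μ : ℝ)

/-- The Riccati iterate with `k` stages to go. -/
def VToGo : ℕ → Matrix (Fin n) (Fin n) ℝ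
  | 0 => inflated Q W μ
  | k + 1 => riccati A B R (inflated Q W μ) (VToGo k)

/-- The iterate of `S` with `k` stages to go. -/
def SToGo : ℕ → Matrix (Fin n) (Fin n) ℝ
  | 0 => Q
  | k + 1 => (closedLoop A B R (VToGo A B R Q W μ k))ᵀ * SToGo k + Q

/-- The iterate of `T` with `k` stages to go. -/
def TToGo : ℕ → Matrix (Fin n) (Fin n) ℝ
  | 0 => 0
  | k + 1 => (closedLoop A B R (VToGo A B R Q W μ k))ᵀ * (TToGo k + VToGo A B R Q W μ k)

/-- `V_t` for the horizon `N` (meaningful for `t ≤ N`). -/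
def Vt (N t : ℕ) : Matrix (Fin n) (Fin n) ℝ := VToGo A B R Q W μ (N - t)

/-- `S_t` for the horizon `N` (meaningful for `t ≤ N`). -/
def St (N t : ℕ) : Matrix (Fin n) (Fin n) ℝ := SToGo A B R Q W μ (N - t)

/-- `T_t` for the horizon `N` (meaningful for `t ≤ N`). -/
def Tt (N t : ℕ) : Matrix (Fin n) (Fin n) ℝ := TToGo A B R Q W μ (N - t)

/-- `K_t` for the horizon `N` (meaningful for `t < N`). -/
def Kt (N t : ℕ) : Matrix (Fin p) (Fin n) ℝ := gain A B R (Vt A B R Q W μ N (t + 1))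

/-- The affine input `-2 μ (B'VB + R)⁻¹ B' S M₃`. -/
def lOf (V S : Matrix (Fin n) (Fin n) ℝ) (M₃ : Fin n → ℝ) : Fin p → ℝ :=
  -((2 * μ) • (((Bᵀ * V * B + R)⁻¹ * Bᵀ * S) *ᵥ M₃))

/-- The affine input `-(B'VB + R)⁻¹ B' (V + T) w̄`. -/
def hOf (V T : Matrix (Fin n) (Fin n) ℝ) (wbar : Fin n → ℝ) : Fin p → ℝ :=
  -(((Bᵀ * V * B + R)⁻¹ * Bᵀ * (V + T)) *ᵥ wbar)

/-- `l_t` for the horizon `N` (meaningful for `t < N`). -/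
def ltVec (M₃ : Fin n → ℝ) (N t : ℕ) : Fin p → ℝ :=
  lOf B R μ (Vt A B R Q W μ N (t + 1)) (St A B R Q W μ N (t + 1)) M₃

/-- `h_t` for the horizon `N` (meaningful for `t < N`). -/
def htVec (wbar : Fin n → ℝ) (N t : ℕ) : Fin p → ℝ :=
  hOf B R (Vt A B R Q W μ N (t + 1)) (Tt A B R Q W μ N (t + 1)) wbar

/-- Terminal values of the backward recursions. -/
theorem terminal (N : ℕ) :
    Vt A B R Q W μ N N = inflated Q W μ ∧ St A B R Q W μ N N = Q ∧ Tt A B R Q W μ N N = 0 := by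
  simp [Vt, St, Tt, VToGo, SToGo, TToGo]

/-- The backward recursions for `V_t`, `S_t` and `T_t`. -/
theorem backward (N t : ℕ) (h : t < N) :
    Vt A B R Q W μ N t = riccati A B R (inflated Q W μ) (Vt A B R Q W μ N (t + 1)) ∧
    St A B R Q W μ N t =
      (A + B * Kt A B R Q W μ N t)ᵀ * St A B R Q W μ N (t + 1) + Q ∧
    Tt A B R Q W μ N t =
      (A + B * Kt A B R Q W μ N t)ᵀ * (Tt A B R Q W μ N (t + 1) + Vt A B R Q W μ N (t + 1)) := by
  obtain ⟨k, rfl⟩ := Nat.exists_eq_add_of_lt h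
  have h1 : t + k + 1 - t = k + 1 := by omega
  have h2 : t + k + 1 - (t + 1) = k := by omega
  simp only [Vt, St, Tt, Kt, h1, h2]
  exact ⟨rfl, rfl, rfl⟩

end Riccati

/-- Exponential convergence, as the horizon `N` tends to infinity, of the stage-`t` quantity
`X N t` to `L`: the error is at most `C γ ^ (N - t)`, with constants that depend neither on the
stage nor on the horizon. Matrices carry the operator norm of the sup norm of vectors; the
notion does not depend on the norm. -/
def ConvergesExp {E : Type*} [NormedAddCommGroup E] (X : ℕ → ℕ → E) (L : E) : Prop :=
  ∃ C γ : ℝ, 0 < γ ∧ γ < 1 ∧ ∀ N t : ℕ, t < N → ‖X N t - L‖ ≤ C * γ ^ (N - t)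

end RiskLQR

end

open Filter Topology

/-! The noise enters the Riccati recursion only through `W`. Since `W` is positive semidefinite and
`μ ≥ 0`, the penalty satisfies `Q_μ ≥ Q`, and the problem becomes a deterministic one. The iterates
increase (`iterate_mono`) and stay below the cost of a fixed stabilizing feedback, so they converge
to a positive semidefinite solution `V` (`exists_tendsto_iterate`). Along the closed loop of `V` the
form `x'Vx` drops by at least `x'Qx + x'K'RKx` per step. Hence `√Q x_k` and `K x_k` tend to zero,
and output injection gives `x_k → 0` (`stable_of_detectable`).

Uniqueness and rate both rest on `riccati_sub_transpose`. For two stabilizing solutions it forces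
the difference to vanish. For the iterates it makes the error recursion a vanishing perturbation of
`X ↦ M'XM`, with `M` the stable closed loop, so the error is geometric (`geomTendsto_iterate`). Then
`S` and `T` obey affine recursions with coefficients converging geometrically to `M'`
(`geomTendsto_of_affine`), while `K`, `l`, `h` are algebraic expressions in `V`, `S`, `T`. -/

namespace RiskLQR

/-! ### Perturbed contractive recursions in a normed ring -/

section Recursions

theorem exists_pow_gt_half (m : ℕ) : ∃ γ : ℝ, 0 < γ ∧ γ < 1 ∧ 1 / 2 < γ ^ m := by
  have h1 : Tendsto (fun γ : ℝ => γ ^ m) (𝓝[<] 1) (𝓝 1) := by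
    have : Tendsto (fun γ : ℝ => γ ^ m) (𝓝 1) (𝓝 (1 ^ m)) := (continuous_pow m).tendsto 1
    rw [one_pow] at this
    exact this.mono_left nhdsWithin_le_nhds
  have h2 : ∀ᶠ γ : ℝ in 𝓝[<] 1, 1 / 2 < γ ^ m := h1.eventually_const_lt (by norm_num)
  have h3 : ∀ᶠ γ : ℝ in 𝓝[<] 1, γ ∈ Set.Ioo (0 : ℝ) 1 := Ioo_mem_nhdsLT (by norm_num)
  obtain ⟨γ, h, h'⟩ := (h2.and h3).exists
  exact ⟨γ, h'.1, h'.2, h⟩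

/-- A norm adapted to the contraction `X ↦ P X M`. -/
theorem exists_adapted_norm {α : Type*} [NormedRing α] {P M : α}
    (h : Tendsto (fun k => ‖P ^ k‖ * ‖M ^ k‖) atTop (𝓝 0)) :
    ∃ (f : α → ℝ) (γ c : ℝ), 0 < γ ∧ γ < 1 ∧ 0 ≤ c ∧ (∀ x, ‖x‖ ≤ f x) ∧ (∀ x, f x ≤ c * ‖x‖) ∧
      (∀ x y, f (x + y) ≤ f x + f y) ∧ ∀ x, f (P * x * M) ≤ γ * f x := by
  obtain ⟨m, hm, hm1⟩ :=
    ((h.eventually_lt_const (show (0 : ℝ) < 1 / 2 by norm_num)).and (eventually_ge_atTop 1)).exists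
  obtain ⟨γ, hγ0, hγ1, hγm⟩ := exists_pow_gt_half m
  have hb : ∀ j (x : α), ‖P ^ j * x * M ^ j‖ ≤ ‖P ^ j‖ * ‖M ^ j‖ * ‖x‖ := fun j x => by
    calc ‖P ^ j * x * M ^ j‖ ≤ ‖P ^ j‖ * ‖x‖ * ‖M ^ j‖ :=
          (norm_mul_le _ _).trans (by gcongr; exact norm_mul_le _ _)
      _ = _ := by ring
  have hpos : ∀ j, 0 < (γ ^ j)⁻¹ := fun j => by positivity
  -- Replacing `x` by `P x M` shifts the index of the sum: up to the factor `γ`, the term `j = 0`,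
  -- which is `‖x‖`, is traded for the term `j = m`. The latter is at most `‖x‖` because `‖P ^ m‖ *
  -- ‖M ^ m‖ < 1 / 2 < γ ^ m`.
  refine ⟨fun x => ∑ j ∈ Finset.range m, (γ ^ j)⁻¹ * ‖P ^ j * x * M ^ j‖, γ,
    ∑ j ∈ Finset.range m, (γ ^ j)⁻¹ * (‖P ^ j‖ * ‖M ^ j‖), hγ0, hγ1, by positivity, ?_, ?_, ?_, ?_⟩
  · intro x
    have := Finset.single_le_sum (f := fun j => (γ ^ j)⁻¹ * ‖P ^ j * x * M ^ j‖)
      (fun j _ => by positivity) (Finset.mem_range.2 hm1)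
    simpa using this
  · intro x
    rw [Finset.sum_mul]
    refine Finset.sum_le_sum fun j _ => ?_
    rw [mul_assoc _ _ ‖x‖]
    exact mul_le_mul_of_nonneg_left (hb j x) (hpos j).le
  · intro x y
    rw [← Finset.sum_add_distrib]
    refine Finset.sum_le_sum fun j _ => ?_
    rw [← mul_add, mul_add (P ^ j), add_mul]
    exact mul_le_mul_of_nonneg_left (norm_add_le _ _) (hpos j).le
  · intro x
    have e : ∀ j, (γ ^ j)⁻¹ * ‖P ^ j * (P * x * M) * M ^ j‖ =
        γ * ((γ ^ (j + 1))⁻¹ * ‖P ^ (j + 1) * x * M ^ (j + 1)‖) := fun j => by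
      rw [pow_succ P, pow_succ' M, pow_succ γ]
      simp only [mul_assoc]
      field_simp
    simp only [e]
    rw [← Finset.mul_sum]
    refine mul_le_mul_of_nonneg_left ?_ hγ0.le
    have s1 := Finset.sum_range_succ (fun j => (γ ^ j)⁻¹ * ‖P ^ j * x * M ^ j‖) m
    have s2 := Finset.sum_range_succ' (fun j => (γ ^ j)⁻¹ * ‖P ^ j * x * M ^ j‖) m
    have last : (γ ^ m)⁻¹ * ‖P ^ m * x * M ^ m‖ ≤ ‖x‖ := by
      rw [inv_mul_le_iff₀ (by positivity)]
      refine (hb m x).trans ?_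
      gcongr
      linarith
    simp only [pow_zero, one_mul, mul_one, inv_one] at s2
    linarith

theorem bounded_of_contracting {a : ℕ → ℝ} {γ c : ℝ} (hγ0 : 0 < γ) (hγ1 : γ < 1) (hc : 0 ≤ c)
    (ha : ∀ k, 0 ≤ a k) (h : ∀ k, a (k + 1) ≤ γ * a k + c) (k : ℕ) :
    a k ≤ a 0 + c / (1 - γ) := by
  have h1 : 0 < 1 - γ := by linarith
  induction k with
  | zero => have := div_nonneg hc h1.le; linarith
  | succ k ih =>
    have e : c = c / (1 - γ) * (1 - γ) := by field_simp
    have := ha 0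
    nlinarith [h k, mul_le_mul_of_nonneg_left ih hγ0.le]

theorem geometric_of_contracting {a δ : ℕ → ℝ} {γ C η : ℝ} (hγ0 : 0 < γ) (hγ1 : γ < 1)
    (hη0 : 0 < η) (hη1 : η < 1) (hC : 0 ≤ C) (ha : ∀ k, 0 ≤ a k) (hδ : Tendsto δ atTop (𝓝 0))
    (h : ∀ k, a (k + 1) ≤ γ * a k + δ k * a k + C * η ^ k) :
    ∃ C' r : ℝ, 0 < r ∧ r < 1 ∧ ∀ k, a k ≤ C' * r ^ k := by
  obtain ⟨s, hs, hs1⟩ := exists_between (max_lt hγ1 hη1)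
  obtain ⟨r, hr, hr1⟩ := exists_between hs1
  have hγs := (le_max_left γ η).trans_lt hs
  have hηs := (le_max_right γ η).trans_lt hs
  have hr0 : 0 < r := by linarith
  obtain ⟨k₀, hk₀⟩ := eventually_atTop.1 (hδ.eventually_lt_const (sub_pos.2 hγs))
  have hrs : 0 < r - s := by linarith
  -- `D` pays for the indices up to `k₀`. The summand `C / (r - s)` absorbs the forcing later on,
  -- since `s * c + C ≤ r * c` as soon as `c ≥ C / (r - s)`.
  set D := ∑ j ∈ Finset.range (k₀ + 1), a j / r ^ j with hD
  have hD0 : 0 ≤ D := Finset.sum_nonneg fun j _ => div_nonneg (ha j) (by positivity)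
  have hCr : 0 ≤ C / (r - s) := div_nonneg hC hrs.le
  have base : ∀ k ≤ k₀, a k ≤ (C / (r - s) + D) * r ^ k := fun k hk => by
    have := Finset.single_le_sum (f := fun j => a j / r ^ j)
      (fun j _ => div_nonneg (ha j) (by positivity)) (Finset.mem_range.2 (Nat.lt_succ_of_le hk))
    rw [← div_le_iff₀ (by positivity)]
    linarith
  refine ⟨C / (r - s) + D, r, hr0, hr1, fun k => ?_⟩
  rcases le_total k k₀ with hk | hk
  · exact base k hk
  · induction k, hk using Nat.le_induction with
    | base => exact base _ le_rfl
    | succ k hk ih =>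
      have h1 : η ^ k ≤ r ^ k := by gcongr; linarith
      have h2 : γ * a k + δ k * a k ≤ s * a k := by
        rw [← add_mul]
        exact mul_le_mul_of_nonneg_right (by linarith [hk₀ k hk]) (ha k)
      calc a (k + 1) ≤ s * a k + C * η ^ k := (h k).trans (by linarith)
        _ ≤ s * ((C / (r - s) + D) * r ^ k) + C * r ^ k := by gcongr; linarith
        _ ≤ s * ((C / (r - s) + D) * r ^ k) + (r - s) * (C / (r - s) + D) * r ^ k := by
            gcongr
            rw [mul_add, mul_div_cancel₀ _ hrs.ne']
            have := mul_nonneg hrs.le hD0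
            linarith
        _ = _ := by ring

/-- Once `ε k < (1 - γ) * (b / 2)`, the recursion is dominated by one with fixed point `b / 2`,
which attracts at rate `γ`. -/
theorem tendsto_zero_of_contracting {a ε : ℕ → ℝ} {γ : ℝ} (hγ0 : 0 < γ) (hγ1 : γ < 1)
    (ha : ∀ k, 0 ≤ a k) (hε : Tendsto ε atTop (𝓝 0)) (h : ∀ k, a (k + 1) ≤ γ * a k + ε k) :
    Tendsto a atTop (𝓝 0) := by
  have h1 : 0 < 1 - γ := by linarith
  refine tendsto_order.2 ⟨fun b hb => Eventually.of_forall fun k => hb.trans_le (ha k),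
    fun b hb => ?_⟩
  obtain ⟨k₀, hk₀⟩ := eventually_atTop.1
    (hε.eventually_lt_const (show 0 < (1 - γ) * (b / 2) by positivity))
  have key : ∀ j, a (k₀ + j) ≤ γ ^ j * a k₀ + b / 2 := fun j => by
    induction j with
    | zero => simp; linarith
    | succ j ih =>
      have := h (k₀ + j)
      have h2 := hk₀ (k₀ + j) (by omega)
      rw [← add_assoc, pow_succ']
      nlinarith [mul_le_mul_of_nonneg_left ih hγ0.le]
  have hp : Tendsto (fun j => γ ^ j * a k₀ + b / 2) atTop (𝓝 (0 * a k₀ + b / 2)) :=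
    ((tendsto_pow_atTop_nhds_zero_of_lt_one hγ0.le hγ1).mul_const _).add_const _
  obtain ⟨j₀, hj₀⟩ := eventually_atTop.1
    (hp.eventually_lt_const (show 0 * a k₀ + b / 2 < b by linarith))
  filter_upwards [eventually_ge_atTop (k₀ + j₀)] with k hk
  have e : k₀ + (k - k₀) = k := by omega
  have := key (k - k₀)
  rw [e] at this
  exact this.trans_lt (hj₀ _ (by omega))

variable {α : Type*} [NormedRing α] {P M : α}

theorem bounded_of_recursion (h : Tendsto (fun k => ‖P ^ k‖ * ‖M ^ k‖) atTop (𝓝 0)) {x : ℕ → α}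
    (u : α) (hx : ∀ k, x (k + 1) = P * x k * M + u) : ∃ b, ∀ k, ‖x k‖ ≤ b := by
  obtain ⟨f, γ, c, hγ0, hγ1, hc, h1, h2, h3, h4⟩ := exists_adapted_norm h
  have h0 : ∀ y, 0 ≤ f y := fun y => (norm_nonneg y).trans (h1 y)
  refine ⟨_, fun k => (h1 _).trans (bounded_of_contracting (a := fun k => f (x k)) hγ0 hγ1 (h0 u)
    (fun k => h0 _) (fun k => ?_) k)⟩
  simp only [hx]
  linarith [h3 (P * x k * M) u, h4 (x k)]

theorem tendsto_zero_of_recursion (h : Tendsto (fun k => ‖P ^ k‖ * ‖M ^ k‖) atTop (𝓝 0))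
    {x u : ℕ → α} (hu : Tendsto u atTop (𝓝 0)) (hx : ∀ k, x (k + 1) = P * x k * M + u k) :
    Tendsto x atTop (𝓝 0) := by
  obtain ⟨f, γ, c, hγ0, hγ1, hc, h1, h2, h3, h4⟩ := exists_adapted_norm h
  have h0 : ∀ y, 0 ≤ f y := fun y => (norm_nonneg y).trans (h1 y)
  have hε : Tendsto (fun k => c * ‖u k‖) atTop (𝓝 0) := by
    simpa using (tendsto_zero_iff_norm_tendsto_zero.1 hu).const_mul c
  refine squeeze_zero_norm (fun k => h1 (x k)) (tendsto_zero_of_contracting hγ0 hγ1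
    (fun k => h0 _) hε fun k => ?_)
  rw [hx]
  linarith [h3 (P * x k * M) (u k), h4 (x k), h2 (u k)]

/-- Upgrades qualitative convergence to a rate: the factor `δ k` only has to tend to zero, because
in the adapted norm it eventually fits into the gap between `γ` and 1. -/
theorem geometric_of_recursion (h : Tendsto (fun k => ‖P ^ k‖ * ‖M ^ k‖) atTop (𝓝 0))
    {x u : ℕ → α} {δ : ℕ → ℝ} {C η : ℝ} (hC : 0 ≤ C) (hη0 : 0 < η) (hη1 : η < 1)
    (hδ : Tendsto δ atTop (𝓝 0)) (hδ0 : ∀ k, 0 ≤ δ k)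
    (hu : ∀ k, ‖u k‖ ≤ δ k * ‖x k‖ + C * η ^ k) (hx : ∀ k, x (k + 1) = P * x k * M + u k) :
    ∃ C' r : ℝ, 0 < r ∧ r < 1 ∧ ∀ k, ‖x k‖ ≤ C' * r ^ k := by
  obtain ⟨f, γ, c, hγ0, hγ1, hc, h1, h2, h3, h4⟩ := exists_adapted_norm h
  have h0 : ∀ y, 0 ≤ f y := fun y => (norm_nonneg y).trans (h1 y)
  have hδ' : Tendsto (fun k => c * δ k) atTop (𝓝 0) := by simpa using hδ.const_mul c
  obtain ⟨C', r, hr0, hr1, hr⟩ := geometric_of_contracting (a := fun k => f (x k)) (C := c * C)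
    hγ0 hγ1 hη0 hη1 (mul_nonneg hc hC) (fun k => h0 _) hδ' (fun k => by
      simp only [hx]
      have e1 := mul_le_mul_of_nonneg_left (hu k) hc
      have e2 := mul_le_mul_of_nonneg_left (h1 (x k)) (mul_nonneg hc (hδ0 k))
      linarith [h3 (P * x k * M) (u k), h4 (x k), h2 (u k)])
  exact ⟨C', r, hr0, hr1, fun k => (h1 _).trans (hr k)⟩

end Recursions

/-! ### Schur stability and powers of matrices -/

section Stability

variable {n : ℕ}

/-- The norm sees only absolute values of entries, so spectral radius estimates over `ℂ` transfer to
real powers. -/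
theorem norm_map_complex (M : Matrix (Fin n) (Fin n) ℝ) : ‖M.map (algebraMap ℝ ℂ)‖ = ‖M‖ := by
  simp [Matrix.linfty_opNorm_def]

theorem map_complex_pow (M : Matrix (Fin n) (Fin n) ℝ) (k : ℕ) :
    (M.map (algebraMap ℝ ℂ)) ^ k = (M ^ k).map (algebraMap ℝ ℂ) :=
  (map_pow (algebraMap ℝ ℂ).mapMatrix M k).symm

/-- By Gelfand's formula `‖M ^ k‖ ≤ r ^ k` eventually, for any `r` strictly between the spectral
radius and 1. -/
theorem IsSchurStable.tendsto_pow {M : Matrix (Fin n) (Fin n) ℝ} (h : IsSchurStable M) :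
    Tendsto (fun k => M ^ k) atTop (𝓝 0) := by
  refine tendsto_zero_iff_norm_tendsto_zero.2 ?_
  obtain ⟨r, hr, hr1⟩ := ENNReal.lt_iff_exists_nnreal_btwn.1 h
  have hr1 : r < 1 := by exact_mod_cast hr1
  have hg := spectrum.pow_nnnorm_pow_one_div_tendsto_nhds_spectralRadius
    (M.map (algebraMap ℝ ℂ))
  have hp : Tendsto (fun k => (r : ℝ) ^ k) atTop (𝓝 0) :=
    tendsto_pow_atTop_nhds_zero_of_lt_one r.2 (by exact_mod_cast hr1)
  refine squeeze_zero' (Eventually.of_forall fun k => norm_nonneg _) ?_ hp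
  filter_upwards [hg.eventually_lt_const hr, eventually_ge_atTop 1] with k hk hk1
  have hk0 : (k : ℝ) ≠ 0 := by positivity
  have := ENNReal.rpow_le_rpow hk.le (show (0 : ℝ) ≤ k by positivity)
  rw [← ENNReal.rpow_mul, one_div, inv_mul_cancel₀ hk0, ENNReal.rpow_one,
    ENNReal.rpow_natCast] at this
  have h2 : ‖(M.map (algebraMap ℝ ℂ)) ^ k‖₊ ≤ r ^ k := by exact_mod_cast this
  rw [map_complex_pow] at h2
  rw [← norm_map_complex]
  exact_mod_cast h2

theorem IsSchurStable.of_tendsto_pow {M : Matrix (Fin n) (Fin n) ℝ}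
    (h : Tendsto (fun k => M ^ k) atTop (𝓝 0)) : IsSchurStable M := by
  replace h := tendsto_zero_iff_norm_tendsto_zero.1 h
  rw [← tendsto_add_atTop_iff_nat 1] at h
  obtain ⟨k, hk⟩ := (h.eventually_lt_const one_pos).exists
  -- In dimension zero `‖1‖ = 1` fails, so this case is separate.
  rcases isEmpty_or_nonempty (Fin n) with hn | hn
  · rw [IsSchurStable, Subsingleton.elim (M.map (algebraMap ℝ ℂ)) 0]
    simp
  refine (spectrum.spectralRadius_le_pow_nnnorm_pow_one_div ℂ (M.map (algebraMap ℝ ℂ)) k).trans_lt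
    ?_
  have h1 : ‖(1 : Matrix (Fin n) (Fin n) ℂ)‖₊ = 1 := by
    simp
  rw [h1, map_complex_pow]
  have h2 : ‖(M ^ (k + 1)).map (algebraMap ℝ ℂ)‖₊ < 1 := by
    rw [← NNReal.coe_lt_coe, coe_nnnorm, norm_map_complex]
    exact_mod_cast hk
  simp only [ENNReal.coe_one, ENNReal.one_rpow, mul_one]
  exact ENNReal.rpow_lt_one (by exact_mod_cast h2) (by positivity)

theorem tendsto_pow_transpose {M : Matrix (Fin n) (Fin n) ℝ}
    (h : Tendsto (fun k => M ^ k) atTop (𝓝 0)) : Tendsto (fun k => Mᵀ ^ k) atTop (𝓝 0) := by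
  have := (continuous_id.matrix_transpose.tendsto (0 : Matrix (Fin n) (Fin n) ℝ)).comp h
  simpa [Function.comp_def, Matrix.transpose_pow] using this

theorem tendsto_norm_pow_mul {P M : Matrix (Fin n) (Fin n) ℝ}
    (hP : Tendsto (fun k => P ^ k) atTop (𝓝 0)) (hM : Tendsto (fun k => M ^ k) atTop (𝓝 0)) :
    Tendsto (fun k => ‖P ^ k‖ * ‖M ^ k‖) atTop (𝓝 0) := by
  simpa using hP.norm.mul hM.norm

/-- Taking the right factor to be 1 lets the two-sided recursion lemmas serve one-sided recursions.
-/
theorem tendsto_norm_pow_mul_one {P : Matrix (Fin n) (Fin n) ℝ}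
    (hP : Tendsto (fun k => P ^ k) atTop (𝓝 0)) :
    Tendsto (fun k => ‖P ^ k‖ * ‖(1 : Matrix (Fin n) (Fin n) ℝ) ^ k‖) atTop (𝓝 0) := by
  simpa using hP.norm.mul_const ‖(1 : Matrix (Fin n) (Fin n) ℝ)‖

theorem eq_zero_of_eq_conj {P M X : Matrix (Fin n) (Fin n) ℝ}
    (hP : Tendsto (fun k => P ^ k) atTop (𝓝 0)) (hM : Tendsto (fun k => M ^ k) atTop (𝓝 0))
    (h : X = P * X * M) : X = 0 := by
  have := tendsto_zero_of_recursion (tendsto_norm_pow_mul hP hM) (x := fun _ => X)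
    (u := fun _ => 0) tendsto_const_nhds (fun _ => by simpa using h)
  exact tendsto_nhds_unique tendsto_const_nhds this

/-- `1 - M` is a factor of `1 - M ^ k`, which is invertible once `‖M ^ k‖ < 1`. -/
theorem isUnit_one_sub_of_tendsto_pow {M : Matrix (Fin n) (Fin n) ℝ}
    (h : Tendsto (fun k => M ^ k) atTop (𝓝 0)) : IsUnit (1 - M) := by
  obtain ⟨k, hk⟩ := (h.norm.eventually_lt_const (u := 1) (by simp)).exists
  have h1 : IsUnit (1 - M ^ k) := isUnit_one_sub_of_norm_lt_one hk
  rw [← mul_neg_geom_sum, Matrix.isUnit_iff_isUnit_det, Matrix.det_mul] at h1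
  rw [Matrix.isUnit_iff_isUnit_det]
  exact isUnit_of_mul_isUnit_left h1

end Stability

/-! ### Algebra and monotonicity of the Riccati map -/

section Algebra

variable {n p : ℕ} {A : Matrix (Fin n) (Fin n) ℝ} {B : Matrix (Fin n) (Fin p) ℝ}
  {R : Matrix (Fin p) (Fin p) ℝ} {Qm : Matrix (Fin n) (Fin n) ℝ}

/-- For symmetric `V` and `R` this is the first-order optimality condition of the one-step cost; the
identity itself needs no symmetry. -/
theorem weight_mul_gain {V : Matrix (Fin n) (Fin n) ℝ} (hV : IsUnit (Bᵀ * V * B + R)) :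
    Bᵀ * V * closedLoop A B R V + R * gain A B R V = 0 := by
  have h : (Bᵀ * V * B + R) * gain A B R V = -(Bᵀ * V * A) := by
    rw [gain, Matrix.mul_neg, Matrix.mul_assoc _ _ A, Matrix.mul_assoc _ _ (V * A),
      Matrix.mul_nonsing_inv_cancel_left _ _ ((Matrix.isUnit_iff_isUnit_det _).1 hV),
      ← Matrix.mul_assoc]
  rw [closedLoop, Matrix.mul_add, add_assoc, ← Matrix.mul_assoc, ← Matrix.add_mul, h, add_neg_cancel]

theorem riccati_eq_transpose_mul (V : Matrix (Fin n) (Fin n) ℝ) :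
    riccati A B R Qm V = Aᵀ * V * closedLoop A B R V + Qm := by
  rw [riccati, closedLoop, gain]
  simp only [Matrix.mul_add, Matrix.mul_neg, Matrix.mul_assoc]
  abel

/-- The Riccati map evaluated with an arbitrary feedback `F` on the left. -/
theorem riccati_eq_cross {V : Matrix (Fin n) (Fin n) ℝ} (hV : IsUnit (Bᵀ * V * B + R))
    (F : Matrix (Fin p) (Fin n) ℝ) :
    riccati A B R Qm V =
      (A + B * F)ᵀ * V * closedLoop A B R V + Fᵀ * R * gain A B R V + Qm := by
  have h := congrArg (Fᵀ * ·) (weight_mul_gain (A := A) hV)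
  simp only [Matrix.mul_add, Matrix.mul_zero, ← Matrix.mul_assoc] at h
  rw [riccati_eq_transpose_mul, Matrix.transpose_add, Matrix.transpose_mul, Matrix.add_mul,
    Matrix.add_mul, add_assoc (_ * _ * _) (_ * _ * _) (_ * _ * _), h, add_zero]

/-- Two Riccati images differ by a two-sided product with the two closed loops. -/
theorem riccati_sub_transpose {V₁ V₂ : Matrix (Fin n) (Fin n) ℝ} (hR : Rᵀ = R) (hQm : Qmᵀ = Qm)
    (h₁ : IsUnit (Bᵀ * V₁ * B + R)) (h₂ : IsUnit (Bᵀ * V₂ * B + R)) :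
    riccati A B R Qm V₁ - (riccati A B R Qm V₂)ᵀ =
      (closedLoop A B R V₂)ᵀ * (V₁ - V₂ᵀ) * closedLoop A B R V₁ := by
  rw [riccati_eq_cross h₁ (gain A B R V₂), riccati_eq_cross h₂ (gain A B R V₁)]
  rw [show A + B * gain A B R V₂ = closedLoop A B R V₂ from rfl,
    show A + B * gain A B R V₁ = closedLoop A B R V₁ from rfl]
  simp only [Matrix.transpose_add, Matrix.transpose_mul, Matrix.transpose_transpose, hR, hQm,
    Matrix.mul_assoc, Matrix.sub_mul, Matrix.mul_sub]
  abel

/-- Solutions are not assumed symmetric. Comparing `V₁` with the transpose of `V₂` makes the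
difference a fixed point of a map whose iterates tend to zero; the case `V₁ = V₂` then yields
symmetry. -/
theorem IsStabilizingSolution.eq_transpose {V₁ V₂ : Matrix (Fin n) (Fin n) ℝ} (hR : Rᵀ = R)
    (hQm : Qmᵀ = Qm) (h₁ : IsStabilizingSolution A B R Qm V₁)
    (h₂ : IsStabilizingSolution A B R Qm V₂) : V₁ = V₂ᵀ := by
  have h := riccati_sub_transpose (A := A) hR hQm h₁.isUnit h₂.isUnit
  rw [← h₁.eq, ← h₂.eq] at h
  exact sub_eq_zero.1 (eq_zero_of_eq_conj (tendsto_pow_transpose h₂.stable.tendsto_pow)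
    h₁.stable.tendsto_pow h)

theorem IsStabilizingSolution.unique {V₁ V₂ : Matrix (Fin n) (Fin n) ℝ} (hR : Rᵀ = R)
    (hQm : Qmᵀ = Qm) (h₁ : IsStabilizingSolution A B R Qm V₁)
    (h₂ : IsStabilizingSolution A B R Qm V₂) : V₁ = V₂ :=
  (h₁.eq_transpose hR hQm h₂).trans (h₂.eq_transpose hR hQm h₂).symm

/-- The one-step cost of the feedback `F` with cost-to-go `V`. -/
def stepCost (A : Matrix (Fin n) (Fin n) ℝ) (B : Matrix (Fin n) (Fin p) ℝ)
    (R : Matrix (Fin p) (Fin p) ℝ) (Qm : Matrix (Fin n) (Fin n) ℝ) (F : Matrix (Fin p) (Fin n) ℝ)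
    (V : Matrix (Fin n) (Fin n) ℝ) : Matrix (Fin n) (Fin n) ℝ :=
  (A + B * F)ᵀ * V * (A + B * F) + Fᵀ * R * F + Qm

theorem riccati_eq_stepCost {V : Matrix (Fin n) (Fin n) ℝ} (hV : IsUnit (Bᵀ * V * B + R)) :
    riccati A B R Qm V = stepCost A B R Qm (gain A B R V) V :=
  riccati_eq_cross hV _

/-- Completion of the square: the terms linear in `F - gain A B R V` cancel by `weight_mul_gain` and
its transpose. -/
theorem stepCost_sub_riccati {V : Matrix (Fin n) (Fin n) ℝ} (hR : Rᵀ = R) (hs : Vᵀ = V)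
    (hV : IsUnit (Bᵀ * V * B + R)) (F : Matrix (Fin p) (Fin n) ℝ) :
    stepCost A B R Qm F V - riccati A B R Qm V =
      (F - gain A B R V)ᵀ * (Bᵀ * V * B + R) * (F - gain A B R V) := by
  rw [riccati_eq_stepCost hV, stepCost, stepCost]
  obtain ⟨D, hD⟩ : ∃ D, F = gain A B R V + D := ⟨F - gain A B R V, by abel⟩
  have h1 := weight_mul_gain (A := A) hV
  have h2 := congrArg Matrix.transpose h1
  rw [closedLoop] at h1 h2
  replace h1 := congrArg (Dᵀ * ·) h1
  replace h2 := congrArg (· * D) h2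
  subst hD
  generalize gain A B R V = K at *
  simp only [Matrix.transpose_add, Matrix.transpose_mul, Matrix.transpose_transpose, hR, hs,
    Matrix.mul_assoc, Matrix.add_mul, Matrix.mul_add, Matrix.mul_zero, Matrix.zero_mul,
    Matrix.transpose_zero, add_sub_cancel_left] at h1 h2 ⊢
  rw [← sub_eq_zero]
  rw [← add_zero (0 : Matrix (Fin n) (Fin n) ℝ)]
  nth_rewrite 1 [← h1]
  rw [← h2]
  abel

theorem PosSemidef.transpose_eq {m : ℕ} {V : Matrix (Fin m) (Fin m) ℝ} (h : V.PosSemidef) :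
    Vᵀ = V := by
  rw [← Matrix.conjTranspose_eq_transpose_of_trivial]
  exact h.isHermitian

theorem PosSemidef.conj {m k : ℕ} {V : Matrix (Fin m) (Fin m) ℝ} (h : V.PosSemidef)
    (F : Matrix (Fin m) (Fin k) ℝ) : (Fᵀ * V * F).PosSemidef := by
  rw [← Matrix.conjTranspose_eq_transpose_of_trivial]
  exact h.conjTranspose_mul_mul_same F

theorem posDef_weight (hR : R.PosDef) {V : Matrix (Fin n) (Fin n) ℝ} (hV : V.PosSemidef) :
    (Bᵀ * V * B + R).PosDef :=
  Matrix.PosDef.posSemidef_add (PosSemidef.conj hV B) hR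

theorem posSemidef_riccati_sub (hR : R.PosDef) {V : Matrix (Fin n) (Fin n) ℝ}
    (hV : V.PosSemidef) : (riccati A B R Qm V - Qm).PosSemidef := by
  rw [riccati_eq_stepCost (posDef_weight hR hV).isUnit, stepCost, add_sub_cancel_right]
  exact (PosSemidef.conj hV _).add (PosSemidef.conj hR.posSemidef _)

theorem posSemidef_riccati (hR : R.PosDef) (hQm : Qm.PosSemidef) {V : Matrix (Fin n) (Fin n) ℝ}
    (hV : V.PosSemidef) : (riccati A B R Qm V).PosSemidef := by
  simpa using (posSemidef_riccati_sub (A := A) (B := B) (Qm := Qm) hR hV).add hQm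

theorem riccati_le_stepCost (hR : R.PosDef) {V : Matrix (Fin n) (Fin n) ℝ} (hV : V.PosSemidef)
    (F : Matrix (Fin p) (Fin n) ℝ) : (stepCost A B R Qm F V - riccati A B R Qm V).PosSemidef := by
  rw [stepCost_sub_riccati (PosSemidef.transpose_eq hR.posSemidef) (PosSemidef.transpose_eq hV)
    (posDef_weight hR hV).isUnit]
  exact PosSemidef.conj (posDef_weight hR hV).posSemidef _

theorem stepCost_mono {V₁ V₂ : Matrix (Fin n) (Fin n) ℝ} (h : (V₂ - V₁).PosSemidef)
    (F : Matrix (Fin p) (Fin n) ℝ) :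
    (stepCost A B R Qm F V₂ - stepCost A B R Qm F V₁).PosSemidef := by
  have e : stepCost A B R Qm F V₂ - stepCost A B R Qm F V₁ =
      (A + B * F)ᵀ * (V₂ - V₁) * (A + B * F) := by
    rw [stepCost, stepCost, Matrix.mul_sub, Matrix.sub_mul]
    abel
  rw [e]
  exact PosSemidef.conj h _

/-- The gain optimal for `V₂` is merely admissible for `V₁`, so using it for both costs gives the
comparison. -/
theorem riccati_mono (hR : R.PosDef) {V₁ V₂ : Matrix (Fin n) (Fin n) ℝ} (h₁ : V₁.PosSemidef)
    (h₂ : V₂.PosSemidef) (h : (V₂ - V₁).PosSemidef) :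
    (riccati A B R Qm V₂ - riccati A B R Qm V₁).PosSemidef := by
  have e1 := stepCost_mono (A := A) (B := B) (R := R) (Qm := Qm) h (gain A B R V₂)
  have e2 := riccati_le_stepCost (A := A) (B := B) (Qm := Qm) hR h₁ (gain A B R V₂)
  rw [riccati_eq_stepCost (posDef_weight hR h₂).isUnit]
  simpa using e1.add e2

end Algebra

/-! ### Limits of symmetric and positive semidefinite matrices -/

section MonotoneLimits

variable {n : ℕ}

theorem bilin_single (V : Matrix (Fin n) (Fin n) ℝ) (i j : Fin n) :
    Pi.single i 1 ⬝ᵥ V *ᵥ Pi.single j 1 = V i j := by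
  simp

theorem polarization {V : Matrix (Fin n) (Fin n) ℝ} (hV : Vᵀ = V) (i j : Fin n) :
    V i j = ((Pi.single i 1 + Pi.single j 1) ⬝ᵥ V *ᵥ (Pi.single i 1 + Pi.single j 1) -
      Pi.single i 1 ⬝ᵥ V *ᵥ Pi.single i 1 - Pi.single j 1 ⬝ᵥ V *ᵥ Pi.single j 1) / 2 := by
  have h : V j i = V i j := congrFun (congrFun hV i) j
  simp only [Matrix.mulVec_add, dotProduct_add, add_dotProduct, bilin_single, h]
  ring

/-- A monotone sequence of symmetric matrices with bounded quadratic forms converges. -/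
theorem exists_tendsto_of_monotone {V : ℕ → Matrix (Fin n) (Fin n) ℝ} (hs : ∀ k, (V k)ᵀ = V k)
    (hmono : ∀ k, (V (k + 1) - V k).PosSemidef)
    (hb : ∀ x, ∃ b, ∀ k, x ⬝ᵥ V k *ᵥ x ≤ b) : ∃ L, Tendsto V atTop (𝓝 L) := by
  have hq : ∀ x, ∃ l, Tendsto (fun k => x ⬝ᵥ V k *ᵥ x) atTop (𝓝 l) := fun x => by
    obtain ⟨b, hb⟩ := hb x
    refine ⟨_, tendsto_atTop_ciSup (monotone_nat_of_le_succ fun k => ?_)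
      ⟨b, by rintro _ ⟨k, rfl⟩; exact hb k⟩⟩
    have := (hmono k).dotProduct_mulVec_nonneg x
    rw [star_trivial, Matrix.sub_mulVec, dotProduct_sub] at this
    linarith
  choose q hq using hq
  refine ⟨Matrix.of fun i j => (q (Pi.single i 1 + Pi.single j 1) - q (Pi.single i 1) -
    q (Pi.single j 1)) / 2, tendsto_pi_nhds.2 fun i => tendsto_pi_nhds.2 fun j => ?_⟩
  refine Tendsto.congr (fun k => (polarization (hs k) i j).symm) ?_
  rw [Matrix.of_apply]
  exact (((hq (Pi.single i 1 + Pi.single j 1)).sub (hq (Pi.single i 1))).sub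
    (hq (Pi.single j 1))).div_const 2

theorem transpose_eq_of_tendsto {V : ℕ → Matrix (Fin n) (Fin n) ℝ} {L : Matrix (Fin n) (Fin n) ℝ}
    (h : Tendsto V atTop (𝓝 L)) (hs : ∀ k, (V k)ᵀ = V k) : Lᵀ = L := by
  have := (continuous_id.matrix_transpose.tendsto L).comp h
  simp only [Function.comp_def, id, hs] at this
  exact tendsto_nhds_unique this h

theorem continuous_quadratic (x : Fin n → ℝ) :
    Continuous fun V : Matrix (Fin n) (Fin n) ℝ => x ⬝ᵥ V *ᵥ x :=
  continuous_const.dotProduct (continuous_id.matrix_mulVec continuous_const)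

theorem posSemidef_of_tendsto {V : ℕ → Matrix (Fin n) (Fin n) ℝ} {L : Matrix (Fin n) (Fin n) ℝ}
    (h : Tendsto V atTop (𝓝 L)) (hs : ∀ k, (V k).PosSemidef) : L.PosSemidef := by
  refine Matrix.PosSemidef.of_dotProduct_mulVec_nonneg ?_ fun x => ?_
  · rw [Matrix.IsHermitian, Matrix.conjTranspose_eq_transpose_of_trivial]
    exact transpose_eq_of_tendsto h fun k => PosSemidef.transpose_eq (hs k)
  · refine ge_of_tendsto (((continuous_quadratic (star x)).tendsto L).comp h)
      (Eventually.of_forall fun k => ?_)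
    exact (hs k).dotProduct_mulVec_nonneg x

theorem tendsto_zero_of_quadratic {V : ℕ → Matrix (Fin n) (Fin n) ℝ} (hs : ∀ k, (V k)ᵀ = V k)
    (hq : ∀ x, Tendsto (fun k => x ⬝ᵥ V k *ᵥ x) atTop (𝓝 0)) : Tendsto V atTop (𝓝 0) := by
  refine tendsto_pi_nhds.2 fun i => tendsto_pi_nhds.2 fun j => ?_
  refine Tendsto.congr (fun k => (polarization (hs k) i j).symm) ?_
  have := (((hq (Pi.single i 1 + Pi.single j 1)).sub (hq (Pi.single i 1))).sub
    (hq (Pi.single j 1))).div_const 2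
  rw [sub_zero, sub_zero, zero_div] at this
  exact this

/-- Squeeze theorem for sequences of positive semidefinite matrices. -/
theorem tendsto_zero_of_le {V U : ℕ → Matrix (Fin n) (Fin n) ℝ} (hV : ∀ k, (V k).PosSemidef)
    (hU : ∀ k, (U k - V k).PosSemidef) (h : Tendsto U atTop (𝓝 0)) : Tendsto V atTop (𝓝 0) := by
  refine tendsto_zero_of_quadratic (fun k => PosSemidef.transpose_eq (hV k)) fun x => ?_
  have h1 := ((continuous_quadratic x).tendsto 0).comp h
  rw [Matrix.zero_mulVec, dotProduct_zero] at h1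
  refine squeeze_zero (fun k => ?_) (fun k => ?_) h1
  · have := (hV k).dotProduct_mulVec_nonneg x
    rwa [star_trivial] at this
  · have := (hU k).dotProduct_mulVec_nonneg x
    rw [star_trivial, Matrix.sub_mulVec, dotProduct_sub] at this
    simp only [Function.comp_apply]
    linarith

/-- A diagonal entry of `XᵀX` is the sum of squares of a column, so it dominates the square of each
entry in that column. -/
theorem tendsto_zero_of_transpose_mul {m : ℕ} {X : ℕ → Matrix (Fin m) (Fin n) ℝ}
    (h : Tendsto (fun k => (X k)ᵀ * X k) atTop (𝓝 0)) : Tendsto X atTop (𝓝 0) := by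
  refine tendsto_pi_nhds.2 fun i => tendsto_pi_nhds.2 fun j => ?_
  have hj := tendsto_pi_nhds.1 (tendsto_pi_nhds.1 h j) j
  have hsq : Tendsto (fun k => X k i j ^ 2) atTop (𝓝 0) := by
    refine squeeze_zero (fun k => sq_nonneg _) (fun k => ?_) hj
    rw [Matrix.mul_apply]
    have := Finset.single_le_sum (f := fun l => (X k)ᵀ j l * X k l j)
      (fun l _ => mul_self_nonneg _) (Finset.mem_univ i)
    simpa [sq] using this
  have := (Real.continuous_sqrt.tendsto 0).comp hsq
  simp only [Function.comp_def, Real.sqrt_sq_eq_abs, Real.sqrt_zero] at this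
  exact (tendsto_zero_iff_abs_tendsto_zero _).2 this

theorem sqrt_transpose {V : Matrix (Fin n) (Fin n) ℝ} : (CFC.sqrt V)ᵀ = CFC.sqrt V :=
  PosSemidef.transpose_eq (Matrix.nonneg_iff_posSemidef.1 (CFC.sqrt_nonneg V))

theorem sqrt_mul_sqrt {V : Matrix (Fin n) (Fin n) ℝ} (hV : V.PosSemidef) :
    CFC.sqrt V * CFC.sqrt V = V :=
  CFC.sqrt_mul_sqrt_self V (Matrix.nonneg_iff_posSemidef.2 hV)

theorem tendsto_sqrt_mul {m : ℕ} {V : Matrix (Fin m) (Fin m) ℝ} (hV : V.PosSemidef)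
    {X : ℕ → Matrix (Fin m) (Fin n) ℝ} (h : Tendsto (fun k => (X k)ᵀ * V * X k) atTop (𝓝 0)) :
    Tendsto (fun k => CFC.sqrt V * X k) atTop (𝓝 0) := by
  refine tendsto_zero_of_transpose_mul (h.congr fun k => ?_)
  conv_lhs => rw [← sqrt_mul_sqrt hV]
  rw [Matrix.transpose_mul, sqrt_transpose]
  simp only [Matrix.mul_assoc]

end MonotoneLimits

/-! ### Calculus of geometric convergence -/

section GeometricConvergence

/-- Convergence of a sequence with a geometric error bound. -/
def GeomTendsto {E : Type*} [NormedAddCommGroup E] (x : ℕ → E) (L : E) : Prop :=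
  ∃ C γ : ℝ, 0 < γ ∧ γ < 1 ∧ ∀ k, ‖x k - L‖ ≤ C * γ ^ k

variable {E F G : Type*} [NormedAddCommGroup E] [NormedAddCommGroup F] [NormedAddCommGroup G]

theorem GeomTendsto.nonneg_bound {x : ℕ → E} {L : E} (h : GeomTendsto x L) :
    ∃ C γ : ℝ, 0 ≤ C ∧ 0 < γ ∧ γ < 1 ∧ ∀ k, ‖x k - L‖ ≤ C * γ ^ k := by
  obtain ⟨C, γ, h0, h1, h⟩ := h
  refine ⟨C, γ, ?_, h0, h1, h⟩
  simpa using (norm_nonneg _).trans (h 0)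

theorem GeomTendsto.tendsto_norm {x : ℕ → E} {L : E} (h : GeomTendsto x L) :
    Tendsto (fun k => ‖x k - L‖) atTop (𝓝 0) := by
  obtain ⟨C, γ, h0, h1, h⟩ := h
  refine squeeze_zero (fun k => norm_nonneg _) h ?_
  simpa using (tendsto_pow_atTop_nhds_zero_of_lt_one h0.le h1).const_mul C

theorem GeomTendsto.norm_bounded {x : ℕ → E} {L : E} (h : GeomTendsto x L) :
    ∃ b, 0 ≤ b ∧ ∀ k, ‖x k‖ ≤ b := by
  obtain ⟨C, γ, hC, h0, h1, h⟩ := h.nonneg_bound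
  refine ⟨C + ‖L‖, by positivity, fun k => ?_⟩
  have h2 : C * γ ^ k ≤ C := mul_le_of_le_one_right hC (pow_le_one₀ h0.le h1.le)
  have h3 : ‖x k‖ ≤ ‖x k - L‖ + ‖L‖ := by simpa using norm_add_le (x k - L) L
  linarith [h k]

theorem geomTendsto_const (L : E) : GeomTendsto (fun _ => L) L :=
  ⟨0, 1 / 2, by norm_num, by norm_num, fun k => by simp⟩

theorem GeomTendsto.of_norm_le {x : ℕ → E} {a : E} {y : ℕ → F} {b : F} {z : ℕ → G} {c : G}
    (hx : GeomTendsto x a) (hy : GeomTendsto y b) (s t : ℝ)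
    (hz : ∀ k, ‖z k - c‖ ≤ s * ‖x k - a‖ + t * ‖y k - b‖) : GeomTendsto z c := by
  obtain ⟨C, γ, hC, hγ0, hγ1, hx⟩ := hx.nonneg_bound
  obtain ⟨D, η, hD, hη0, hη1, hy⟩ := hy.nonneg_bound
  refine ⟨|s| * C + |t| * D, max γ η, lt_max_of_lt_left hγ0, max_lt hγ1 hη1, fun k => ?_⟩
  calc ‖z k - c‖ ≤ |s| * ‖x k - a‖ + |t| * ‖y k - b‖ := by
        refine (hz k).trans ?_
        gcongr <;> exact le_abs_self _
    _ ≤ |s| * (C * max γ η ^ k) + |t| * (D * max γ η ^ k) := by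
        gcongr
        · refine (hx k).trans ?_
          gcongr
          exact le_max_left _ _
        · refine (hy k).trans ?_
          gcongr
          exact le_max_right _ _
    _ = _ := by ring

theorem GeomTendsto.of_norm_le_mul {x : ℕ → E} {a : E} {z : ℕ → G} {c : G}
    (hx : GeomTendsto x a) (s : ℝ) (hz : ∀ k, ‖z k - c‖ ≤ s * ‖x k - a‖) : GeomTendsto z c :=
  hx.of_norm_le hx s 0 fun k => by simpa using hz k

theorem GeomTendsto.add {x y : ℕ → E} {a b : E} (hx : GeomTendsto x a) (hy : GeomTendsto y b) :
    GeomTendsto (fun k => x k + y k) (a + b) :=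
  hx.of_norm_le hy 1 1 fun k => by
    rw [add_sub_add_comm, one_mul, one_mul]
    exact norm_add_le _ _

theorem GeomTendsto.neg {x : ℕ → E} {a : E} (hx : GeomTendsto x a) :
    GeomTendsto (fun k => -x k) (-a) :=
  hx.of_norm_le_mul 1 fun k => by rw [← neg_sub', norm_neg, one_mul]

theorem GeomTendsto.const_smul [NormedSpace ℝ E] {x : ℕ → E} {a : E} (hx : GeomTendsto x a)
    (r : ℝ) : GeomTendsto (fun k => r • x k) (r • a) :=
  hx.of_norm_le_mul |r| fun k => by rw [← smul_sub, norm_smul, Real.norm_eq_abs]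

theorem GeomTendsto.convergesExp {x : ℕ → E} {a : E} (hx : GeomTendsto x a) :
    ConvergesExp (fun N t => x (N - t)) a := by
  obtain ⟨C, γ, h0, h1, h⟩ := hx
  exact ⟨C, γ, h0, h1, fun N t _ => h _⟩

theorem GeomTendsto.convergesExp_succ {x : ℕ → E} {a : E} (hx : GeomTendsto x a) :
    ConvergesExp (fun N t => x (N - (t + 1))) a := by
  obtain ⟨C, γ, h0, h1, h⟩ := hx
  -- The index `N - (t + 1)` is one short of the exponent `N - t`, which costs one factor `γ⁻¹`.
  refine ⟨C * γ⁻¹, γ, h0, h1, fun N t ht => (h _).trans (le_of_eq ?_)⟩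
  obtain ⟨k, rfl⟩ := Nat.exists_eq_add_of_lt ht
  rw [show t + k + 1 - (t + 1) = k by omega, show t + k + 1 - t = k + 1 by omega, pow_succ]
  field_simp

variable {k l m : ℕ}

theorem GeomTendsto.matrix_mul {x : ℕ → Matrix (Fin k) (Fin l) ℝ}
    {y : ℕ → Matrix (Fin l) (Fin m) ℝ} {a : Matrix (Fin k) (Fin l) ℝ}
    {b : Matrix (Fin l) (Fin m) ℝ} (hx : GeomTendsto x a) (hy : GeomTendsto y b) :
    GeomTendsto (fun i => x i * y i) (a * b) := by
  obtain ⟨c, hc, hb⟩ := hy.norm_bounded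
  refine hx.of_norm_le hy c ‖a‖ fun i => ?_
  rw [show x i * y i - a * b = (x i - a) * y i + a * (y i - b) by
    rw [Matrix.sub_mul, Matrix.mul_sub]; abel]
  refine (norm_add_le _ _).trans (add_le_add ((Matrix.linfty_opNorm_mul _ _).trans ?_)
    (Matrix.linfty_opNorm_mul _ _))
  rw [mul_comm]
  exact mul_le_mul_of_nonneg_right (hb i) (norm_nonneg _)

theorem GeomTendsto.mulVec {x : ℕ → Matrix (Fin k) (Fin l) ℝ} {a : Matrix (Fin k) (Fin l) ℝ}
    (hx : GeomTendsto x a) (v : Fin l → ℝ) : GeomTendsto (fun i => x i *ᵥ v) (a *ᵥ v) := by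
  refine hx.of_norm_le_mul ‖v‖ fun i => ?_
  rw [← Matrix.sub_mulVec, mul_comm]
  exact Matrix.linfty_opNorm_mulVec _ _

/-- The maximal row sum is not invariant under transposition; a row of `Xᵀ` has `k` entries, each
bounded by `‖X‖`. -/
theorem norm_transpose_le (X : Matrix (Fin k) (Fin l) ℝ) : ‖Xᵀ‖ ≤ k * ‖X‖ := by
  have h : ∀ i j, ‖X j i‖₊ ≤ ‖X‖₊ := fun i j => by
    rw [Matrix.linfty_opNNNorm_def]
    exact (Finset.single_le_sum (f := fun i => ‖X j i‖₊) (fun _ _ => zero_le)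
      (Finset.mem_univ i)).trans
      (Finset.le_sup (f := fun j => ∑ i, ‖X j i‖₊) (Finset.mem_univ j))
  have h2 : ‖Xᵀ‖₊ ≤ k * ‖X‖₊ := by
    rw [Matrix.linfty_opNNNorm_def Xᵀ]
    refine Finset.sup_le fun i _ => ?_
    refine (Finset.sum_le_sum (g := fun _ => ‖X‖₊) fun j _ => h i j).trans ?_
    simp
  exact_mod_cast h2

theorem GeomTendsto.transpose {x : ℕ → Matrix (Fin k) (Fin l) ℝ} {a : Matrix (Fin k) (Fin l) ℝ}
    (hx : GeomTendsto x a) : GeomTendsto (fun i => (x i)ᵀ) aᵀ :=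
  hx.of_norm_le_mul k fun i => by
    rw [← Matrix.transpose_sub]
    exact norm_transpose_le _

theorem tendsto_matrix_inv {x : ℕ → Matrix (Fin k) (Fin k) ℝ} {a : Matrix (Fin k) (Fin k) ℝ}
    (hx : Tendsto x atTop (𝓝 a)) (ha : IsUnit a) : Tendsto (fun i => (x i)⁻¹) atTop (𝓝 a⁻¹) := by
  simp only [Matrix.nonsing_inv_eq_ringInverse]
  obtain ⟨u, rfl⟩ := ha
  exact (NormedRing.inverse_continuousAt u).tendsto.comp hx

theorem GeomTendsto.tendsto_matrix {x : ℕ → Matrix (Fin k) (Fin l) ℝ}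
    {a : Matrix (Fin k) (Fin l) ℝ} (hx : GeomTendsto x a) : Tendsto x atTop (𝓝 a) :=
  tendsto_iff_norm_sub_tendsto_zero.2 hx.tendsto_norm

theorem GeomTendsto.matrix_inv {x : ℕ → Matrix (Fin k) (Fin k) ℝ} {a : Matrix (Fin k) (Fin k) ℝ}
    (hx : GeomTendsto x a) (ha : IsUnit a) (hu : ∀ i, IsUnit (x i)) :
    GeomTendsto (fun i => (x i)⁻¹) a⁻¹ := by
  obtain ⟨b, hb⟩ := (tendsto_matrix_inv hx.tendsto_matrix ha).norm.bddAbove_range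
  refine hx.of_norm_le_mul (b * ‖a⁻¹‖) fun i => ?_
  have e : (x i)⁻¹ - a⁻¹ = (x i)⁻¹ * (a - x i) * a⁻¹ := by
    rw [Matrix.mul_sub, Matrix.sub_mul, Matrix.nonsing_inv_mul _
      ((Matrix.isUnit_iff_isUnit_det _).1 (hu i)), Matrix.mul_assoc, Matrix.mul_nonsing_inv _
      ((Matrix.isUnit_iff_isUnit_det _).1 ha), Matrix.mul_one, Matrix.one_mul]
  have hbi : ‖(x i)⁻¹‖ ≤ b := hb ⟨i, rfl⟩
  rw [e]
  calc ‖(x i)⁻¹ * (a - x i) * a⁻¹‖ ≤ ‖(x i)⁻¹‖ * ‖a - x i‖ * ‖a⁻¹‖ :=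
        (norm_mul_le _ _).trans (by gcongr; exact norm_mul_le _ _)
    _ ≤ b * ‖x i - a‖ * ‖a⁻¹‖ := by rw [norm_sub_rev]; gcongr
    _ = _ := by ring

/-- A recursion whose coefficients converge geometrically to a stable matrix. -/
theorem geomTendsto_of_affine {P : ℕ → Matrix (Fin k) (Fin k) ℝ} {P' : Matrix (Fin k) (Fin k) ℝ}
    (hP : GeomTendsto P P') (hst : Tendsto (fun i => P' ^ i) atTop (𝓝 0))
    {x c : ℕ → Matrix (Fin k) (Fin k) ℝ} {a c' : Matrix (Fin k) (Fin k) ℝ}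
    (hc : GeomTendsto c c') (hx : ∀ i, x (i + 1) = P i * x i + c i) (ha : a = P' * a + c') :
    GeomTendsto x a := by
  obtain ⟨C, η, hC, hη0, hη1, hu⟩ := ((hP.matrix_mul (geomTendsto_const a)).add hc).nonneg_bound
  -- The error obeys the limiting linear recursion up to a term small relative to the error and the
  -- geometric residual of `a` in the actual recursion.
  have := geometric_of_recursion (tendsto_norm_pow_mul_one hst) (x := fun i => x i - a)
    (u := fun i => (P i - P') * (x i - a) + (P i * a + c i - (P' * a + c')))
    (δ := fun i => ‖P i - P'‖) hC hη0 hη1 hP.tendsto_norm (fun i => norm_nonneg _)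
    (fun i => (norm_add_le _ _).trans (add_le_add (norm_mul_le _ _) (hu i)))
    (fun i => by
      rw [hx]
      nth_rewrite 1 [ha]
      noncomm_ring)
  obtain ⟨C', r, h0, h1, h⟩ := this
  exact ⟨C', r, h0, h1, h⟩

end GeometricConvergence

/-! ### Convergence of the Riccati iteration and stability of its limit -/

section RiccatiLimit

variable {n p : ℕ} {A : Matrix (Fin n) (Fin n) ℝ} {B : Matrix (Fin n) (Fin p) ℝ}
  {R : Matrix (Fin p) (Fin p) ℝ} {Qm : Matrix (Fin n) (Fin n) ℝ}
  {V : ℕ → Matrix (Fin n) (Fin n) ℝ}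

theorem quadratic_le (x : Fin n → ℝ) (M : Matrix (Fin n) (Fin n) ℝ) :
    x ⬝ᵥ M *ᵥ x ≤ (∑ i, |x i|) * (‖M‖ * ‖x‖) := by
  rw [dotProduct, Finset.sum_mul]
  refine Finset.sum_le_sum fun i _ => (le_abs_self _).trans ?_
  rw [abs_mul]
  refine mul_le_mul_of_nonneg_left ?_ (abs_nonneg _)
  exact (norm_le_pi_norm (M *ᵥ x) i).trans (Matrix.linfty_opNorm_mulVec _ _)

theorem posSemidef_iterate (hR : R.PosDef) (hQm : Qm.PosSemidef) (h0 : V 0 = Qm)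
    (hV : ∀ k, V (k + 1) = riccati A B R Qm (V k)) (k : ℕ) : (V k).PosSemidef := by
  induction k with
  | zero => rwa [h0]
  | succ k ih => rw [hV]; exact posSemidef_riccati hR hQm ih

theorem iterate_mono (hR : R.PosDef) (hQm : Qm.PosSemidef) (h0 : V 0 = Qm)
    (hV : ∀ k, V (k + 1) = riccati A B R Qm (V k)) (k : ℕ) : (V (k + 1) - V k).PosSemidef := by
  have hp := posSemidef_iterate hR hQm h0 hV
  induction k with
  | zero =>
    rw [hV]
    nth_rewrite 2 [h0]
    exact posSemidef_riccati_sub hR (hp 0)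
  | succ k ih =>
    rw [hV (k + 1)]
    nth_rewrite 2 [hV k]
    exact riccati_mono hR (hp k) (hp (k + 1)) ih

/-- Under stabilizability the Riccati iteration started at the state penalty converges. -/
theorem exists_tendsto_iterate (hR : R.PosDef) (hQm : Qm.PosSemidef) (hst : IsStabilizable A B)
    (h0 : V 0 = Qm) (hV : ∀ k, V (k + 1) = riccati A B R Qm (V k)) :
    ∃ L, Tendsto V atTop (𝓝 L) := by
  have hp := posSemidef_iterate hR hQm h0 hV
  obtain ⟨F, hF⟩ := hst
  -- `U` is the cost of using `F` at every stage: a linear recursion with stable coefficients, hence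
  -- bounded, and above `V` by optimality.
  set U : ℕ → Matrix (Fin n) (Fin n) ℝ := fun k => (stepCost A B R Qm F)^[k] Qm with hU
  have hUs : ∀ k, U (k + 1) = stepCost A B R Qm F (U k) := fun k =>
    Function.iterate_succ_apply' _ _ _
  obtain ⟨b, hb⟩ := bounded_of_recursion (tendsto_norm_pow_mul
    (tendsto_pow_transpose hF.tendsto_pow) hF.tendsto_pow) (x := U) (Fᵀ * R * F + Qm)
    (fun k => by rw [hUs, stepCost, add_assoc])
  have hle : ∀ k, (U k - V k).PosSemidef := fun k => by
    induction k with
    | zero =>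
      rw [h0, show U 0 = Qm from rfl, sub_self]
      exact Matrix.PosSemidef.zero
    | succ k ih =>
      rw [hUs, hV]
      simpa using (stepCost_mono (A := A) (B := B) (R := R) (Qm := Qm) ih F).add
        (riccati_le_stepCost (A := A) (B := B) (Qm := Qm) hR (hp k) F)
  refine exists_tendsto_of_monotone (fun k => PosSemidef.transpose_eq (hp k))
    (iterate_mono hR hQm h0 hV) fun x => ⟨(∑ i, |x i|) * (b * ‖x‖), fun k => ?_⟩
  have h1 := (hle k).dotProduct_mulVec_nonneg x
  rw [star_trivial, Matrix.sub_mulVec, dotProduct_sub] at h1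
  refine (by linarith : _ ≤ x ⬝ᵥ U k *ᵥ x).trans ((quadratic_le x _).trans ?_)
  have := hb k
  gcongr

theorem tendsto_matrix_mul {k l m : ℕ} {x : ℕ → Matrix (Fin k) (Fin l) ℝ}
    {y : ℕ → Matrix (Fin l) (Fin m) ℝ} {a : Matrix (Fin k) (Fin l) ℝ}
    {b : Matrix (Fin l) (Fin m) ℝ} (hx : Tendsto x atTop (𝓝 a)) (hy : Tendsto y atTop (𝓝 b)) :
    Tendsto (fun i => x i * y i) atTop (𝓝 (a * b)) := by
  have : Continuous fun q : Matrix (Fin k) (Fin l) ℝ × Matrix (Fin l) (Fin m) ℝ => q.1 * q.2 :=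
    continuous_fst.matrix_mul continuous_snd
  exact (this.tendsto (a, b)).comp (hx.prodMk_nhds hy)

theorem tendsto_gain (hR : R.PosDef) {L : Matrix (Fin n) (Fin n) ℝ} (hL : L.PosSemidef)
    (h : Tendsto V atTop (𝓝 L)) :
    Tendsto (fun k => gain A B R (V k)) atTop (𝓝 (gain A B R L)) := by
  have h1 : Tendsto (fun k => Bᵀ * V k * B + R) atTop (𝓝 (Bᵀ * L * B + R)) :=
    (tendsto_matrix_mul (tendsto_matrix_mul tendsto_const_nhds h) tendsto_const_nhds).add_const R
  have h2 := tendsto_matrix_inv h1 (posDef_weight hR hL).isUnit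
  exact (tendsto_matrix_mul (tendsto_matrix_mul (tendsto_matrix_mul h2 tendsto_const_nhds) h)
    tendsto_const_nhds).neg

theorem tendsto_closedLoop (hR : R.PosDef) {L : Matrix (Fin n) (Fin n) ℝ} (hL : L.PosSemidef)
    (h : Tendsto V atTop (𝓝 L)) :
    Tendsto (fun k => closedLoop A B R (V k)) atTop (𝓝 (closedLoop A B R L)) :=
  (tendsto_matrix_mul tendsto_const_nhds (tendsto_gain hR hL h)).const_add A

theorem eq_riccati_of_tendsto (hR : R.PosDef) {L : Matrix (Fin n) (Fin n) ℝ} (hL : L.PosSemidef)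
    (h : Tendsto V atTop (𝓝 L)) (hV : ∀ k, V (k + 1) = riccati A B R Qm (V k)) :
    L = riccati A B R Qm L := by
  refine tendsto_nhds_unique ((tendsto_add_atTop_iff_nat 1).2 h) ?_
  simp only [hV, riccati_eq_transpose_mul]
  exact (tendsto_matrix_mul (tendsto_matrix_mul tendsto_const_nhds h)
    (tendsto_closedLoop hR hL h)).add_const Qm

/-- Under detectability a positive semidefinite solution of the Riccati equation is stabilizing. -/
theorem stable_of_detectable {Q : Matrix (Fin n) (Fin n) ℝ} (hR : R.PosDef) (hQ : Q.PosSemidef)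
    (hQm : (Qm - Q).PosSemidef) (hdet : IsDetectable A (CFC.sqrt Q))
    {L : Matrix (Fin n) (Fin n) ℝ} (hL : L.PosSemidef) (heq : L = riccati A B R Qm L) :
    Tendsto (fun k => closedLoop A B R L ^ k) atTop (𝓝 0) := by
  obtain ⟨J, hJ⟩ := hdet
  set X : ℕ → Matrix (Fin n) (Fin n) ℝ := fun k => closedLoop A B R L ^ k with hX
  set K := gain A B R L with hK
  have hXs : ∀ k, X (k + 1) = (A + B * K) * X k := fun k => pow_succ' _ _
  have heq' : L = (A + B * K)ᵀ * L * (A + B * K) + Kᵀ * R * K + Qm :=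
    heq.trans (riccati_eq_stepCost (posDef_weight hR hL).isUnit)
  -- `L` is a Lyapunov function. The form decreases and is bounded below, so its drops tend to zero,
  -- and so does each of the three positive semidefinite summands.
  have hdrop : ∀ k, (X k)ᵀ * L * X k - (X (k + 1))ᵀ * L * X (k + 1) =
      (X k)ᵀ * (Kᵀ * R * K) * X k + (X k)ᵀ * Q * X k + (X k)ᵀ * (Qm - Q) * X k := fun k => by
    conv_lhs => enter [1]; rw [heq']
    rw [hXs, Matrix.transpose_mul]
    noncomm_ring
  have hp1 : ∀ k, ((X k)ᵀ * (Kᵀ * R * K) * X k).PosSemidef := fun k =>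
    PosSemidef.conj (PosSemidef.conj hR.posSemidef K) _
  have hp2 : ∀ k, ((X k)ᵀ * Q * X k).PosSemidef := fun k => PosSemidef.conj hQ _
  have hp3 : ∀ k, ((X k)ᵀ * (Qm - Q) * X k).PosSemidef := fun k => PosSemidef.conj hQm _
  have hp4 : ∀ k, ((X k)ᵀ * L * X k).PosSemidef := fun k => PosSemidef.conj hL _
  obtain ⟨Z, hZ⟩ := exists_tendsto_of_monotone (V := fun k => -((X k)ᵀ * L * X k))
    (fun k => by rw [Matrix.transpose_neg, PosSemidef.transpose_eq (hp4 k)])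
    (fun k => by
      rw [show -((X (k + 1))ᵀ * L * X (k + 1)) - -((X k)ᵀ * L * X k) =
        (X k)ᵀ * L * X k - (X (k + 1))ᵀ * L * X (k + 1) by abel, hdrop]
      exact ((hp1 k).add (hp2 k)).add (hp3 k))
    (fun x => ⟨0, fun k => by
      have := (hp4 k).dotProduct_mulVec_nonneg x
      rw [star_trivial] at this
      rw [Matrix.neg_mulVec, dotProduct_neg]
      linarith⟩)
  have hdiff : Tendsto (fun k => (X k)ᵀ * (Kᵀ * R * K) * X k + (X k)ᵀ * Q * X k +
      (X k)ᵀ * (Qm - Q) * X k) atTop (𝓝 0) := by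
    have := ((tendsto_add_atTop_iff_nat 1).2 hZ).sub hZ
    rw [sub_self] at this
    refine this.congr fun k => ?_
    rw [← hdrop]
    abel
  have hRK : Tendsto (fun k => CFC.sqrt R * (K * X k)) atTop (𝓝 0) := by
    refine tendsto_sqrt_mul hR.posSemidef ?_
    refine (tendsto_zero_of_le hp1 (fun k => ?_) hdiff).congr fun k => ?_
    · rw [add_assoc, add_sub_cancel_left]
      exact (hp2 k).add (hp3 k)
    · simp only [Matrix.transpose_mul, Matrix.mul_assoc]
  have hQX : Tendsto (fun k => CFC.sqrt Q * X k) atTop (𝓝 0) := by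
    refine tendsto_sqrt_mul hQ (tendsto_zero_of_le hp2 (fun k => ?_) hdiff)
    rw [add_right_comm, add_sub_cancel_right]
    exact (hp1 k).add (hp3 k)
  have hKX : Tendsto (fun k => K * X k) atTop (𝓝 0) := by
    have h1 := tendsto_matrix_mul (tendsto_const_nhds (x := R⁻¹ * CFC.sqrt R)) hRK
    rw [Matrix.mul_zero] at h1
    refine h1.congr fun k => ?_
    rw [Matrix.mul_assoc, ← Matrix.mul_assoc (CFC.sqrt R), sqrt_mul_sqrt hR.posSemidef,
      Matrix.nonsing_inv_mul_cancel_left _ _ ((Matrix.isUnit_iff_isUnit_det _).1 hR.isUnit)]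
  have hu : Tendsto (fun k => B * (K * X k) - J * (CFC.sqrt Q * X k)) atTop (𝓝 0) := by
    have := (tendsto_matrix_mul (tendsto_const_nhds (x := B)) hKX).sub
      (tendsto_matrix_mul (tendsto_const_nhds (x := J)) hQX)
    rwa [Matrix.mul_zero, Matrix.mul_zero, sub_zero] at this
  -- The closed loop is rewritten as the stable `A + J * CFC.sqrt Q` driven by an input already
  -- known to vanish.
  refine tendsto_zero_of_recursion (tendsto_norm_pow_mul_one hJ.tendsto_pow) hu fun k => ?_
  rw [hXs, mul_one]
  simp only [Matrix.add_mul, Matrix.mul_assoc]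
  abel

/-- Geometric convergence of the Riccati iteration to a stabilizing limit. -/
theorem geomTendsto_iterate (hR : R.PosDef) (hQm : Qm.PosSemidef) (h0 : V 0 = Qm)
    (hV : ∀ k, V (k + 1) = riccati A B R Qm (V k)) {L : Matrix (Fin n) (Fin n) ℝ}
    (hL : L.PosSemidef) (h : Tendsto V atTop (𝓝 L))
    (hst : Tendsto (fun k => closedLoop A B R L ^ k) atTop (𝓝 0)) : GeomTendsto V L := by
  have hp := posSemidef_iterate hR hQm h0 hV
  set M := closedLoop A B R L with hM
  have hcl : Tendsto (fun k => closedLoop A B R (V k)) atTop (𝓝 M) := tendsto_closedLoop hR hL h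
  have hδ : Tendsto (fun k => ‖Mᵀ‖ * ‖closedLoop A B R (V k) - M‖) atTop (𝓝 0) := by
    simpa using (tendsto_iff_norm_sub_tendsto_zero.1 hcl).const_mul ‖Mᵀ‖
  -- The exact error map has the closed loop of `V k` on the right; splitting off its limit `M`
  -- leaves a factor that tends to zero.
  have hx : ∀ k, V (k + 1) - L = Mᵀ * (V k - L) * M +
      Mᵀ * (V k - L) * (closedLoop A B R (V k) - M) := fun k => by
    have := riccati_sub_transpose (A := A) (PosSemidef.transpose_eq hR.posSemidef)
      (PosSemidef.transpose_eq hQm) (posDef_weight (B := B) hR (hp k)).isUnit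
      (posDef_weight hR hL).isUnit
    rw [← hV, ← eq_riccati_of_tendsto hR hL h hV, PosSemidef.transpose_eq hL] at this
    rw [this, ← Matrix.mul_add, add_sub_cancel]
  obtain ⟨C, r, h0, h1, hr⟩ := geometric_of_recursion (tendsto_norm_pow_mul
    (tendsto_pow_transpose hst) hst) (x := fun k => V k - L) (C := 0) (η := 1 / 2) le_rfl
    (by norm_num) (by norm_num) hδ (fun k => by positivity) (fun k => by
      rw [zero_mul, add_zero]
      calc _ ≤ ‖Mᵀ‖ * ‖V k - L‖ * ‖closedLoop A B R (V k) - M‖ :=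
            (norm_mul_le _ _).trans (by gcongr; exact norm_mul_le _ _)
        _ = _ := by ring) hx
  exact ⟨C, r, h0, h1, hr⟩

end RiccatiLimit

/-! ### Positivity of the covariance and of the inflation -/

section Covariance

variable {Ω : Type*} [MeasurableSpace Ω] {n : ℕ}

/-- The quadratic form at `x` is the expected square of `x'(ξ - E ξ)`; square integrability
justifies exchanging sums and integral. -/
theorem posSemidef_cov (P : Measure Ω) [IsProbabilityMeasure P] {ξ : Ω → EuclideanSpace ℝ (Fin n)}
    (h : MemLp ξ 4 P) : (cov P ξ).PosSemidef := by
  have hd : ∀ i, MemLp (fun ω => dev P ξ ω i) 2 P := fun i => by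
    have h1 : MemLp (fun ω => ξ ω i) 4 P :=
      h.of_le ((EuclideanSpace.proj i : EuclideanSpace ℝ (Fin n) →L[ℝ] ℝ).continuous
        |>.comp_aestronglyMeasurable h.1) (Eventually.of_forall fun ω => PiLp.norm_apply_le _ i)
    exact (h1.mono_exponent (by norm_num)).sub (memLp_const _)
  have hi : ∀ i j, Integrable (fun ω => dev P ξ ω i * dev P ξ ω j) P := fun i j =>
    (hd i).integrable_mul (hd j)
  refine Matrix.PosSemidef.of_dotProduct_mulVec_nonneg ?_ fun x => ?_
  · ext i j
    simp [cov, mul_comm]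
  · have e : star x ⬝ᵥ cov P ξ *ᵥ x = ∫ ω, (∑ i, x i * dev P ξ ω i) ^ 2 ∂P := by
      have : ∀ ω, (∑ i, x i * dev P ξ ω i) ^ 2 =
          ∑ i, ∑ j, x i * x j * (dev P ξ ω i * dev P ξ ω j) := fun ω => by
        rw [sq, Finset.sum_mul_sum]
        refine Finset.sum_congr rfl fun i _ => Finset.sum_congr rfl fun j _ => by ring
      simp only [this]
      rw [integral_finsetSum _ fun i _ => integrable_finsetSum _ fun j _ =>
        (hi i j).const_mul _]
      simp only [dotProduct, Matrix.mulVec, star_trivial, Finset.mul_sum]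
      refine Finset.sum_congr rfl fun i _ => ?_
      rw [integral_finsetSum _ fun j _ => (hi i j).const_mul _]
      refine Finset.sum_congr rfl fun j _ => ?_
      rw [integral_const_mul, cov, Matrix.of_apply]
      ring
    rw [e]
    exact integral_nonneg fun ω => sq_nonneg _

theorem posSemidef_inflated_sub {Q W : Matrix (Fin n) (Fin n) ℝ} {μ : ℝ} (hQ : Q.PosSemidef)
    (hW : W.PosSemidef) (hμ : 0 ≤ μ) : (inflated Q W μ - Q).PosSemidef := by
  rw [inflated, add_sub_cancel_left]
  have := PosSemidef.conj hW Q
  rw [PosSemidef.transpose_eq hQ] at this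
  exact this.smul (by positivity)

end Covariance

end RiskLQR

/-! ### The main theorem -/

open RiskLQR in
theorem corollary1 {Ω : Type*} [MeasurableSpace Ω] (P : Measure Ω) [IsProbabilityMeasure P]
    {n p : ℕ} (A : Matrix (Fin n) (Fin n) ℝ) (B : Matrix (Fin n) (Fin p) ℝ)
    (Q : Matrix (Fin n) (Fin n) ℝ) (R : Matrix (Fin p) (Fin p) ℝ)
    (w : ℕ → Ω → EuclideanSpace ℝ (Fin n))
    (hindep : iIndepFun w P) (hident : ∀ t, IdentDistrib (w t) (w 0) P P)
    (hmoment : ∀ t, MemLp (w t) 4 P)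
    (hQ : Q.PosSemidef) (hR : R.PosDef)
    (hstab : RiskLQR.IsStabilizable A B) (hdet : RiskLQR.IsDetectable A (CFC.sqrt Q))
    (wbar : Fin n → ℝ) (hwbar : wbar = RiskLQR.mean P (w 0))
    (W : Matrix (Fin n) (Fin n) ℝ) (hW : W = RiskLQR.cov P (w 0))
    (M₃ : Fin n → ℝ) (hM₃ : M₃ = RiskLQR.thirdMoment P (w 0) Q)
    (μ : ℝ) (hμ : 0 ≤ μ) :
    ∃ V : Matrix (Fin n) (Fin n) ℝ,
      RiskLQR.IsStabilizingSolution A B R (RiskLQR.inflated Q W μ) V ∧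
      (∀ V' : Matrix (Fin n) (Fin n) ℝ,
        RiskLQR.IsStabilizingSolution A B R (RiskLQR.inflated Q W μ) V' → V' = V) ∧
      RiskLQR.ConvergesExp (RiskLQR.Vt A B R Q W μ) V ∧
      ∃ (K : Matrix (Fin p) (Fin n) ℝ) (S T : Matrix (Fin n) (Fin n) ℝ) (l h : Fin p → ℝ),
        K = -((Bᵀ * V * B + R)⁻¹ * Bᵀ * V * A) ∧
        IsUnit (1 - (A + B * K)ᵀ) ∧
        S = (1 - (A + B * K)ᵀ)⁻¹ * Q ∧
        T = (1 - (A + B * K)ᵀ)⁻¹ * (A + B * K)ᵀ * V ∧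
        l = -((2 * μ) • (((Bᵀ * V * B + R)⁻¹ * Bᵀ * S) *ᵥ M₃)) ∧
        h = -(((Bᵀ * V * B + R)⁻¹ * Bᵀ * (V + T)) *ᵥ wbar) ∧
        RiskLQR.ConvergesExp (RiskLQR.Kt A B R Q W μ) K ∧
        RiskLQR.ConvergesExp (RiskLQR.St A B R Q W μ) S ∧
        RiskLQR.ConvergesExp (RiskLQR.Tt A B R Q W μ) T ∧
        RiskLQR.ConvergesExp (RiskLQR.ltVec A B R Q W μ M₃) l ∧
        RiskLQR.ConvergesExp (RiskLQR.htVec A B R Q W μ wbar) h ∧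
        spectralRadius ℂ ((A + B * K).map (algebraMap ℝ ℂ)) < 1 := by
  have hWp : W.PosSemidef := hW ▸ posSemidef_cov P (hmoment 0)
  have hsub := posSemidef_inflated_sub hQ hWp hμ
  set Qm := inflated Q W μ with hQm_def
  have hQm : Qm.PosSemidef := by simpa using hsub.add hQ
  have h0 : VToGo A B R Q W μ 0 = Qm := rfl
  have hV : ∀ k, VToGo A B R Q W μ (k + 1) = riccati A B R Qm (VToGo A B R Q W μ k) :=
    fun _ => rfl
  have hp := posSemidef_iterate hR hQm h0 hV
  obtain ⟨V, hlim⟩ := exists_tendsto_iterate hR hQm hstab h0 hV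
  have hVp : V.PosSemidef := posSemidef_of_tendsto hlim hp
  have heq : V = riccati A B R Qm V := eq_riccati_of_tendsto hR hVp hlim hV
  have hpow := stable_of_detectable hR hQ hsub hdet hVp heq
  have hunit := (posDef_weight (B := B) hR hVp).isUnit
  have hsol : IsStabilizingSolution A B R Qm V := ⟨hunit, heq, .of_tendsto_pow hpow⟩
  have hpowT := tendsto_pow_transpose hpow
  have hU : IsUnit (1 - (closedLoop A B R V)ᵀ) := isUnit_one_sub_of_tendsto_pow hpowT
  -- The limits of `S` and `T` are the fixed points with `Y = Q` and `Y = (A + BK)'V`.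
  have hfix : ∀ Y : Matrix (Fin n) (Fin n) ℝ, (1 - (closedLoop A B R V)ᵀ)⁻¹ * Y =
      (closedLoop A B R V)ᵀ * ((1 - (closedLoop A B R V)ᵀ)⁻¹ * Y) + Y := fun Y => by
    have := Matrix.mul_nonsing_inv_cancel_left _ Y ((Matrix.isUnit_iff_isUnit_det _).1 hU)
    rw [Matrix.sub_mul, Matrix.one_mul] at this
    exact sub_eq_iff_eq_add'.1 this
  have gV : GeomTendsto (VToGo A B R Q W μ) V := geomTendsto_iterate hR hQm h0 hV hVp hlim hpow
  have gG : GeomTendsto (fun k => (Bᵀ * VToGo A B R Q W μ k * B + R)⁻¹) (Bᵀ * V * B + R)⁻¹ :=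
    ((((geomTendsto_const _).matrix_mul gV).matrix_mul (geomTendsto_const _)).add
      (geomTendsto_const _)).matrix_inv hunit fun k => (posDef_weight hR (hp k)).isUnit
  have gGB := gG.matrix_mul (geomTendsto_const Bᵀ)
  have gK : GeomTendsto (fun k => gain A B R (VToGo A B R Q W μ k)) (gain A B R V) :=
    ((gGB.matrix_mul gV).matrix_mul (geomTendsto_const A)).neg
  have gC : GeomTendsto (fun k => (closedLoop A B R (VToGo A B R Q W μ k))ᵀ)
      (closedLoop A B R V)ᵀ :=
    ((geomTendsto_const A).add ((geomTendsto_const B).matrix_mul gK)).transpose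
  have gS : GeomTendsto (SToGo A B R Q W μ) ((1 - (closedLoop A B R V)ᵀ)⁻¹ * Q) :=
    geomTendsto_of_affine gC hpowT (geomTendsto_const Q) (fun _ => rfl) (hfix Q)
  have gT : GeomTendsto (TToGo A B R Q W μ)
      ((1 - (closedLoop A B R V)ᵀ)⁻¹ * (closedLoop A B R V)ᵀ * V) := by
    refine geomTendsto_of_affine gC hpowT (gC.matrix_mul gV)
      (fun k => Matrix.mul_add _ _ _) ?_
    rw [Matrix.mul_assoc]
    exact hfix _
  refine ⟨V, hsol, fun V' h' => h'.unique (PosSemidef.transpose_eq hR.posSemidef)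
    (PosSemidef.transpose_eq hQm) hsol, gV.convergesExp, gain A B R V, _, _, _, _, rfl, hU, rfl,
    rfl, rfl, rfl, gK.convergesExp_succ, gS.convergesExp, gT.convergesExp, ?_, ?_, hsol.stable⟩
  · exact (((gGB.matrix_mul gS).mulVec M₃).const_smul (2 * μ)).neg.convergesExp_succ
  · exact ((gGB.matrix_mul (gV.add gT)).mulVec wbar).neg.convergesExp_succ
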